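/- Let $r,s>0$ with $r+s<1$, let $a,b\in\mathbb R$, and let $$\Omega=[0,r]\cup[a,a+s]\cup[b,b+1-r-s],$$ where the half-open intervals $[0,r)$, $[a,a+s)$, $[b,b+1-r-s)$ are pairwise disjoint (this holds in particular if the three closed intervals are pairwise disjoint). Let $\Lambda\subset\mathbb R$ be a spectrum for $\Omega$, that is, the functions $e_\lambda(x)=|\Omega|^{-1/2}e^{2\pi i\lambda x}\chi_\Omega(x)$, $\lambda\in\Lambda$, form an orthonormal basis of $L^2(\Omega)$. Define $\varphi_\Omega:\mathbb R\to\mathbb C^3\times\mathbb C^3$ by $$\varphi_\Omega(x)=\left(e^{2\pi i r x},\,e^{2\pi i(a+s)x},\,e^{2\pi i(b+1-r-s)x};\;1,\,e^{2\pi i a x},\,e^{2\pi i b x}\right),$$ and let $V_\Omega(\Lambda)$ be the complex linear span of $\varphi_\Omega(\Lambda)=\{\varphi_\Omega(\lambda):\lambda\in\Lambda\}$. Then $\dim_{\mathbb C}V_\Omega(\Lambda)=3$. -/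

import Mathlib

open MeasureTheory Set

/-- The exponential `e_l(x) = |Ω|^{-1/2} e^{2 π i l x} χ_Ω(x)`. -/
noncomputable def expFun (Ω : Set ℝ) (l : ℝ) : ℝ → ℂ :=
  Ω.indicator fun x =>
    ((1 / Real.sqrt (volume.real Ω) : ℝ) : ℂ) *
      Complex.exp (2 * (Real.pi : ℂ) * Complex.I * (l : ℂ) * (x : ℂ))

/-- `(Ω, Λ)` is a spectral pair: `Ω` is measurable of finite positive measure and the family of
exponentials `e_l`, `l ∈ Λ`, is an orthonormal (Hilbert) basis of `L²(Ω)`. -/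
def IsSpectralPair (Ω Λ : Set ℝ) : Prop :=
  MeasurableSet Ω ∧ 0 < volume Ω ∧ volume Ω < ⊤ ∧
    ∃ B : HilbertBasis Λ ℂ (Lp ℂ 2 (volume.restrict Ω)),
      ∀ l : Λ, (B l : ℝ → ℂ) =ᵐ[volume.restrict Ω] expFun Ω (l : ℝ)

/-- The embedding attached to `n` intervals with left end points `a j` and lengths `r j`:
`x ↦ ((e^{2 π i (a_j + r_j) x})_j ; (e^{2 π i a_j x})_j)` in `ℂⁿ × ℂⁿ`. -/
noncomputable def spectrumEmbedding {n : ℕ} (a r : Fin n → ℝ) (x : ℝ) :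
    (Fin n → ℂ) × (Fin n → ℂ) :=
  (fun j => Complex.exp (2 * (Real.pi : ℂ) * Complex.I * ((a j + r j : ℝ) : ℂ) * (x : ℂ)),
   fun j => Complex.exp (2 * (Real.pi : ℂ) * Complex.I * ((a j : ℝ) : ℂ) * (x : ℂ)))

/-- The complex linear span of the embedded spectrum. -/
noncomputable def spectrumSpan {n : ℕ} (a r : Fin n → ℝ) (Λ : Set ℝ) :
    Submodule ℂ ((Fin n → ℂ) × (Fin n → ℂ)) :=
  Submodule.span ℂ (spectrumEmbedding a r '' Λ)

open scoped ComplexConjugate InnerProductSpace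

/-! The embedded spectrum spans a Lagrangian subspace for the boundary form of `d/dx` on `n`
intervals: `V` equals its own orthogonal, so `2 dim V = 2n`.

Isotropy is Green's formula applied to two orthogonal exponentials.

For maximality, let `w` be orthogonal to every embedded frequency and let `u` be the piecewise
affine function with endpoint values `w`. By Green's formula `u'` has coefficients `2πil` times
those of `u`, as if the Fourier series could be differentiated termwise. Each endpoint value of `u`
is a combination of inner products with `u` and `u'`, hence continuous in that pair, so by Parseval
it is the sum of the endpoint values of the series. Thus `w` is a convergent sum of multiples of
embedded frequencies, and `V` is closed. -/

/-- The function equal to `g j` on the half-open interval `[a j, a j + r j)`. -/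
noncomputable def piecewiseFun {n : ℕ} (a r : Fin n → ℝ) (g : Fin n → ℝ → ℂ) (x : ℝ) : ℂ :=
  ∑ j, (Ico (a j) (a j + r j)).indicator (g j) x

/-- The exponential `x ↦ e^{2 π i l x}`. -/
noncomputable def expMode (l x : ℝ) : ℂ :=
  Complex.exp (2 * (Real.pi : ℂ) * Complex.I * (l : ℂ) * (x : ℂ))

theorem hasDerivAt_expMode (l x : ℝ) :
    HasDerivAt (expMode l) (2 * (Real.pi : ℂ) * Complex.I * (l : ℂ) * expMode l x) x := by
  have h : HasDerivAt (fun x : ℝ => 2 * (Real.pi : ℂ) * Complex.I * (l : ℂ) * (x : ℂ))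
      (2 * (Real.pi : ℂ) * Complex.I * (l : ℂ)) x := by
    simpa using (Complex.ofRealCLM.hasDerivAt (x := x)).const_mul
      (2 * (Real.pi : ℂ) * Complex.I * (l : ℂ))
  rw [mul_comm]
  exact h.cexp

theorem continuous_expMode (l : ℝ) : Continuous (expMode l) := by
  unfold expMode; fun_prop

theorem conj_expMode (l x : ℝ) : conj (expMode l x) = expMode (-l) x := by
  simp only [expMode, ← Complex.exp_conj]
  congr 1
  simp [Complex.conj_ofNat]

theorem expMode_neg_mul_self (l x : ℝ) : expMode (-l) x * expMode l x = 1 := by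
  simp only [expMode, ← Complex.exp_add]
  simp

theorem expMode_symm (l x : ℝ) :
    Complex.exp (2 * (Real.pi : ℂ) * Complex.I * (x : ℂ) * (l : ℂ)) = expMode l x := by
  unfold expMode; congr 1; ring

/-! ### Piecewise functions on disjoint intervals -/

section PiecewiseFun

variable {n : ℕ} {a r : Fin n → ℝ} {g h : Fin n → ℝ → ℂ}

theorem piecewiseFun_eqOn
    (hd : Pairwise fun i j => Disjoint (Ico (a i) (a i + r i)) (Ico (a j) (a j + r j)))
    {j : Fin n} {x : ℝ} (hx : x ∈ Ico (a j) (a j + r j)) : piecewiseFun a r g x = g j x := by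
  unfold piecewiseFun
  rw [Finset.sum_eq_single j, indicator_of_mem hx]
  · intro k _ hk
    exact indicator_of_notMem (fun h' => (hd hk).le_bot ⟨h', hx⟩) _
  · simp

theorem memLp_piecewiseFun (hg : ∀ j, Continuous (g j)) (s : Set ℝ) :
    MemLp (piecewiseFun a r g) 2 (volume.restrict s) := by
  have : piecewiseFun a r g = fun x => ∑ j, (Ico (a j) (a j + r j)).indicator (g j) x := rfl
  rw [this]
  refine (memLp_finsetSum Finset.univ fun j _ => ?_).mono_measure Measure.restrict_le_self
  rw [memLp_indicator_iff_restrict measurableSet_Ico]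
  obtain ⟨C, hC⟩ := isCompact_Icc.exists_bound_of_continuousOn
    (hg j).continuousOn (s := Icc (a j) (a j + r j))
  exact MemLp.of_bound (hg j).aestronglyMeasurable C
    (ae_restrict_of_forall_mem measurableSet_Ico fun x hx => hC x (Ico_subset_Icc_self hx))

theorem integral_conj_piecewiseFun_mul (hr : ∀ j, 0 ≤ r j)
    (hd : Pairwise fun i j => Disjoint (Ico (a i) (a i + r i)) (Ico (a j) (a j + r j)))
    (hg : ∀ j, Continuous (g j)) (hh : ∀ j, Continuous (h j)) :
    ∫ x in ⋃ j, Ico (a j) (a j + r j), conj (piecewiseFun a r g x) * piecewiseFun a r h x =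
      ∑ j, ∫ x in (a j)..(a j + r j), conj (g j x) * h j x := by
  have key : ∀ j, EqOn (fun x => conj (piecewiseFun a r g x) * piecewiseFun a r h x)
      (fun x => conj (g j x) * h j x) (Ico (a j) (a j + r j)) := fun j x hx => by
    simp only [piecewiseFun_eqOn hd hx]
  rw [integral_iUnion_fintype (fun _ => measurableSet_Ico) hd]
  · refine Finset.sum_congr rfl fun j _ => ?_
    rw [setIntegral_congr_fun measurableSet_Ico (key j), integral_Ico_eq_integral_Ioo,
      ← integral_Ioc_eq_integral_Ioo,
      intervalIntegral.integral_of_le (by linarith [hr j])]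
  · intro j
    refine IntegrableOn.congr_fun ?_ (key j).symm measurableSet_Ico
    have : Continuous fun x => conj (g j x) * h j x :=
      (Complex.continuous_conj.comp (hg j)).mul (hh j)
    exact (this.continuousOn.integrableOn_compact isCompact_Icc).mono_set Ico_subset_Icc_self

end PiecewiseFun

/-! ### Integration by parts on one interval -/

/-- The derivative `u + (x - c) u'` of `(x - c) u`, integrated. -/
theorem integral_add_sub_mul_deriv {u u' : ℝ → ℂ} (hu : ∀ x, HasDerivAt u (u' x) x)
    (hu' : Continuous u') (c p q : ℝ) :
    ∫ x in p..q, (u x + ((x - c : ℝ) : ℂ) * u' x) =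
      ((q - c : ℝ) : ℂ) * u q - ((p - c : ℝ) : ℂ) * u p := by
  have hc : Continuous u := continuous_iff_continuousAt.2 fun x => (hu x).continuousAt
  refine intervalIntegral.integral_eq_sub_of_hasDerivAt
    (f := fun x : ℝ => ((x - c : ℝ) : ℂ) * u x) (fun x _ => ?_) ?_
  · have h1 : HasDerivAt (fun x : ℝ => ((x - c : ℝ) : ℂ)) 1 x := by
      simpa using ((hasDerivAt_id x).sub_const c).ofReal_comp
    have h2 := h1.mul (hu x)
    rw [one_mul] at h2
    exact h2
  · exact Continuous.intervalIntegrable (by fun_prop) _ _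

theorem integral_expMode_neg_mul {u u' : ℝ → ℂ} (hu : ∀ x, HasDerivAt u (u' x) x)
    (hu' : Continuous u') (l p q : ℝ) :
    ∫ x in p..q, expMode (-l) x * u' x =
      expMode (-l) q * u q - expMode (-l) p * u p +
        2 * (Real.pi : ℂ) * Complex.I * (l : ℂ) * ∫ x in p..q, expMode (-l) x * u x := by
  have hc : Continuous u := continuous_iff_continuousAt.2 fun x => (hu x).continuousAt
  have he := continuous_expMode (-l)
  have := intervalIntegral.integral_mul_deriv_eq_deriv_mul (a := p) (b := q)
    (fun x _ => hasDerivAt_expMode (-l) x) (fun x _ => hu x)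
    (Continuous.intervalIntegrable (by fun_prop) _ _) (hu'.intervalIntegrable _ _)
  rw [this, ← intervalIntegral.integral_const_mul, sub_eq_add_neg, ← intervalIntegral.integral_neg]
  congr 2
  ext x
  push_cast
  ring

/-! ### Linear algebra of the boundary form -/

/-- The boundary form of `d/dx` on `n` intervals, of signature `(n, n)`. -/
noncomputable def boundaryForm {n : ℕ} (v w : (Fin n → ℂ) × (Fin n → ℂ)) : ℂ :=
  ∑ j, (conj (v.1 j) * w.1 j - conj (v.2 j) * w.2 j)

/-- A subspace spanned by `S` that is its own orthogonal for the boundary form is Lagrangian. -/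
theorem finrank_span_eq_of_boundaryForm {n : ℕ} {S : Set ((Fin n → ℂ) × (Fin n → ℂ))}
    (hiso : ∀ v ∈ S, ∀ w ∈ S, boundaryForm v w = 0)
    (hmax : ∀ w, (∀ v ∈ S, boundaryForm v w = 0) → w ∈ Submodule.span ℂ S) :
    Module.finrank ℂ (Submodule.span ℂ S) = n := by
  let T : ((Fin n → ℂ) × (Fin n → ℂ)) ≃ₗ[ℂ] EuclideanSpace ℂ (Fin n ⊕ Fin n) :=
    (LinearEquiv.sumArrowLequivProdArrow (Fin n) (Fin n) ℂ ℂ).symm ≪≫ₗ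
      (WithLp.linearEquiv 2 ℂ (Fin n ⊕ Fin n → ℂ)).symm
  -- The sign change on the second factor turns the boundary form into the Hermitian inner product,
  -- so the Hilbert space complement of `T V` is `T' V`, of the same dimension as `V`.
  let T' := (LinearEquiv.prodCongr (LinearEquiv.refl ℂ (Fin n → ℂ))
    (LinearEquiv.neg ℂ (M := Fin n → ℂ))) ≪≫ₗ T
  have inner_eq : ∀ v w, ⟪T v, T' w⟫_ℂ = boundaryForm v w := by
    rintro ⟨v₁, v₂⟩ ⟨w₁, w₂⟩
    simp [T, T', boundaryForm, PiLp.inner_apply, sub_eq_add_neg, Finset.sum_add_distrib, mul_comm]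
  have horth : ((Submodule.span ℂ S).map T.toLinearMap)ᗮ =
      (Submodule.span ℂ S).map T'.toLinearMap := by
    ext y
    obtain ⟨w, rfl⟩ := T'.surjective y
    have hmem : T' w ∈ (Submodule.span ℂ S).map T'.toLinearMap ↔ w ∈ Submodule.span ℂ S :=
      T'.injective.mem_set_image
    rw [hmem, Submodule.map_span, Submodule.mem_orthogonal]
    constructor
    · intro h
      exact hmax w fun v hv => by
        rw [← inner_eq]
        exact h _ (Submodule.subset_span ⟨v, hv, rfl⟩)
    · clear hmem
      intro hw u hu
      induction hu using Submodule.span_induction with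
      | mem u hu =>
        obtain ⟨v, hv, rfl⟩ := hu
        change ⟪T v, T' w⟫_ℂ = 0
        induction hw using Submodule.span_induction with
        | mem w hw => rw [inner_eq, hiso v hv w hw]
        | zero => simp
        | add x y _ _ hx hy => rw [map_add, inner_add_right, hx, hy, add_zero]
        | smul c x _ hx => rw [map_smul, inner_smul_right, hx, mul_zero]
      | zero => simp
      | add x y _ _ hx hy => rw [inner_add_left, hx, hy, add_zero]
      | smul c x _ hx => rw [inner_smul_left, hx, mul_zero]
  have hdim := Submodule.finrank_add_finrank_orthogonal
    ((Submodule.span ℂ S).map T.toLinearMap)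
  rw [horth, LinearEquiv.finrank_map_eq, LinearEquiv.finrank_map_eq, finrank_euclideanSpace,
    Fintype.card_sum, Fintype.card_fin] at hdim
  omega

/-! ### Spectral pairs: Green's formula and Parseval -/

/-- The class in `L²(Ω)` of the piecewise function with pieces `g j`. -/
noncomputable def piecewiseLp {n : ℕ} (a r : Fin n → ℝ) (Ω : Set ℝ) (g : Fin n → ℝ → ℂ)
    (hg : ∀ j, Continuous (g j)) : Lp ℂ 2 (volume.restrict Ω) :=
  (memLp_piecewiseFun (a := a) (r := r) hg Ω).toLp _

section SpectralPair

variable {n : ℕ} {a r : Fin n → ℝ} {Ω Λ : Set ℝ}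

theorem inner_piecewiseLp {g h : Fin n → ℝ → ℂ} (hr : ∀ j, 0 ≤ r j)
    (hd : Pairwise fun i j => Disjoint (Ico (a i) (a i + r i)) (Ico (a j) (a j + r j)))
    (hΩ : Ω =ᵐ[volume] ⋃ j, Ico (a j) (a j + r j))
    (hg : ∀ j, Continuous (g j)) (hh : ∀ j, Continuous (h j)) :
    ⟪piecewiseLp a r Ω g hg, piecewiseLp a r Ω h hh⟫_ℂ =
      ∑ j, ∫ x in (a j)..(a j + r j), conj (g j x) * h j x := by
  rw [← integral_conj_piecewiseFun_mul hr hd hg hh, L2.inner_def, ← Measure.restrict_congr_set hΩ]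
  refine integral_congr_ae ?_
  filter_upwards [(memLp_piecewiseFun (a := a) (r := r) hg Ω).coeFn_toLp,
    (memLp_piecewiseFun (a := a) (r := r) hh Ω).coeFn_toLp] with x hx hx'
  rw [piecewiseLp, piecewiseLp, hx, hx', RCLike.inner_apply, mul_comm]

theorem IsSpectralPair.exists_hilbertBasis_piecewiseLp (hΛ : IsSpectralPair Ω Λ)
    (hd : Pairwise fun i j => Disjoint (Ico (a i) (a i + r i)) (Ico (a j) (a j + r j)))
    (hΩ : Ω =ᵐ[volume] ⋃ j, Ico (a j) (a j + r j)) :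
    ∃ (B : HilbertBasis Λ ℂ (Lp ℂ 2 (volume.restrict Ω))) (c : ℂ), c ≠ 0 ∧ ∀ l : Λ,
      B l = c • piecewiseLp a r Ω (fun _ => expMode l) (fun _ => continuous_expMode l) := by
  obtain ⟨hm, h0, hfin, B, hB⟩ := hΛ
  refine ⟨B, ((1 / Real.sqrt (volume.real Ω) : ℝ) : ℂ), ?_, fun l => Lp.ext ?_⟩
  · have : 0 < volume.real Ω := ENNReal.toReal_pos h0.ne' hfin.ne
    exact Complex.ofReal_ne_zero.2 (by positivity)
  · have hmem : ∀ᵐ x ∂volume.restrict Ω, x ∈ ⋃ j, Ico (a j) (a j + r j) := by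
      rw [Measure.restrict_congr_set hΩ]
      exact ae_restrict_mem (MeasurableSet.iUnion fun _ => measurableSet_Ico)
    filter_upwards [hB l, ae_restrict_mem hm, hmem,
      Lp.coeFn_smul ((1 / Real.sqrt (volume.real Ω) : ℝ) : ℂ)
        (piecewiseLp a r Ω (fun _ => expMode l) (fun _ => continuous_expMode l)),
      (memLp_piecewiseFun (a := a) (r := r) (fun _ => continuous_expMode l) Ω).coeFn_toLp]
      with x h1 h2 h3 h4 h5
    obtain ⟨j, hj⟩ := mem_iUnion.1 h3
    rw [h1, h4, Pi.smul_apply, piecewiseLp, h5, piecewiseFun_eqOn hd hj, expFun,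
      indicator_of_mem h2, smul_eq_mul, expMode]

theorem spectrumEmbedding_eq (l : ℝ) :
    spectrumEmbedding a r l = (fun j => expMode l (a j + r j), fun j => expMode l (a j)) := by
  simp only [spectrumEmbedding, expMode_symm]

theorem boundaryForm_spectrumEmbedding_left (l : ℝ) (w : (Fin n → ℂ) × (Fin n → ℂ)) :
    boundaryForm (spectrumEmbedding a r l) w =
      ∑ j, (expMode (-l) (a j + r j) * w.1 j - expMode (-l) (a j) * w.2 j) := by
  simp only [boundaryForm, spectrumEmbedding_eq, conj_expMode]

/-- Green's formula on a union of intervals. -/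
theorem inner_expMode_deriv_eq {u u' : Fin n → ℝ → ℂ} (hr : ∀ j, 0 ≤ r j)
    (hd : Pairwise fun i j => Disjoint (Ico (a i) (a i + r i)) (Ico (a j) (a j + r j)))
    (hΩ : Ω =ᵐ[volume] ⋃ j, Ico (a j) (a j + r j))
    (hu : ∀ j x, HasDerivAt (u j) (u' j x) x) (huc : ∀ j, Continuous (u j))
    (hu' : ∀ j, Continuous (u' j)) (l : ℝ) :
    ⟪piecewiseLp a r Ω (fun _ => expMode l) (fun _ => continuous_expMode l),
        piecewiseLp a r Ω u' hu'⟫_ℂ =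
      boundaryForm (spectrumEmbedding a r l) (fun j => u j (a j + r j), fun j => u j (a j)) +
        2 * (Real.pi : ℂ) * Complex.I * (l : ℂ) *
          ⟪piecewiseLp a r Ω (fun _ => expMode l) (fun _ => continuous_expMode l),
            piecewiseLp a r Ω u huc⟫_ℂ := by
  simp only [inner_piecewiseLp hr hd hΩ, conj_expMode, boundaryForm_spectrumEmbedding_left]
  rw [Finset.mul_sum, ← Finset.sum_add_distrib]
  exact Finset.sum_congr rfl fun j _ => integral_expMode_neg_mul (hu j) (hu' j) l _ _

/-- For `l ≠ m`, both inner products in Green's formula are multiples of that of the two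
exponentials, which is zero; only the boundary term remains. -/
theorem IsSpectralPair.boundaryForm_eq_zero (hΛ : IsSpectralPair Ω Λ) (hr : ∀ j, 0 ≤ r j)
    (hd : Pairwise fun i j => Disjoint (Ico (a i) (a i + r i)) (Ico (a j) (a j + r j)))
    (hΩ : Ω =ᵐ[volume] ⋃ j, Ico (a j) (a j + r j)) {l m : ℝ} (hl : l ∈ Λ) (hm : m ∈ Λ) :
    boundaryForm (spectrumEmbedding a r l) (spectrumEmbedding a r m) = 0 := by
  rcases eq_or_ne l m with rfl | hne
  -- On the diagonal all coordinates are unimodular, so the two halves of the form cancel.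
  · rw [boundaryForm_spectrumEmbedding_left]
    simp [spectrumEmbedding_eq, expMode_neg_mul_self]
  obtain ⟨B, c, hc, hB⟩ := hΛ.exists_hilbertBasis_piecewiseLp hd hΩ
  have horth : ⟪piecewiseLp a r Ω (fun _ => expMode l) (fun _ => continuous_expMode l),
      piecewiseLp a r Ω (fun _ => expMode m) (fun _ => continuous_expMode m)⟫_ℂ = 0 := by
    have h := B.orthonormal.2 (i := ⟨l, hl⟩) (j := ⟨m, hm⟩) (by simpa using hne)
    beta_reduce at h
    rw [hB, hB, inner_smul_left, inner_smul_right] at h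
    simpa [hc] using h
  have hgreen := inner_expMode_deriv_eq (u := fun _ => expMode m) hr hd hΩ
    (fun _ x => hasDerivAt_expMode m x) (fun _ => continuous_expMode m)
    (fun _ => (continuous_expMode m).const_mul _) l
  rw [horth, mul_zero, add_zero, ← spectrumEmbedding_eq] at hgreen
  rw [← hgreen, inner_piecewiseLp hr hd hΩ]
  rw [inner_piecewiseLp hr hd hΩ] at horth
  simp only [mul_left_comm, intervalIntegral.integral_const_mul, ← Finset.mul_sum]
  simp only [horth, mul_zero]

/-- The endpoint value of a function is recovered from its derivative and itself. -/
theorem inner_single_add_inner_single {u u' : Fin n → ℝ → ℂ} (hr : ∀ j, 0 ≤ r j)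
    (hd : Pairwise fun i j => Disjoint (Ico (a i) (a i + r i)) (Ico (a j) (a j + r j)))
    (hΩ : Ω =ᵐ[volume] ⋃ j, Ico (a j) (a j + r j))
    (hu : ∀ j x, HasDerivAt (u j) (u' j x) x) (huc : ∀ j, Continuous (u j))
    (hu' : ∀ j, Continuous (u' j)) (j : Fin n) (d : ℝ)
    (h₁ : ∀ k, Continuous (Pi.single (M := fun _ => ℝ → ℂ) j (fun _ => 1) k))
    (h₂ : ∀ k, Continuous
      (Pi.single (M := fun _ => ℝ → ℂ) j (fun x => ((x - d : ℝ) : ℂ)) k)) :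
    ⟪piecewiseLp a r Ω _ h₁, piecewiseLp a r Ω u huc⟫_ℂ +
        ⟪piecewiseLp a r Ω _ h₂, piecewiseLp a r Ω u' hu'⟫_ℂ =
      ((a j + r j - d : ℝ) : ℂ) * u j (a j + r j) - ((a j - d : ℝ) : ℂ) * u j (a j) := by
  rw [inner_piecewiseLp hr hd hΩ, inner_piecewiseLp hr hd hΩ, Finset.sum_eq_single j,
    Finset.sum_eq_single j, ← integral_add_sub_mul_deriv (hu j) (hu' j),
    intervalIntegral.integral_add, Pi.single_eq_same, Pi.single_eq_same]
  · simp
  · exact (huc j).intervalIntegrable _ _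
  · have := hu' j
    exact Continuous.intervalIntegrable (by fun_prop) _ _
  · intro k _ hk; simp [hk]
  · simp
  · intro k _ hk; simp [hk]
  · simp

theorem continuous_piSingle {j : Fin n} {f : ℝ → ℂ} (hf : Continuous f) (k : Fin n) :
    Continuous (Pi.single (M := fun _ => ℝ → ℂ) j f k) := by
  rcases eq_or_ne k j with rfl | hk
  · simpa using hf
  · rw [Pi.single_eq_of_ne hk]; exact continuous_zero

/-- If `u'` has Fourier coefficients `2 π i l` times those of `u`, then the combination of
endpoint values of `u` weighted by `x - d` is the sum of those of its Fourier series. -/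
theorem IsSpectralPair.hasSum_boundary (hr : ∀ j, 0 ≤ r j)
    (hd : Pairwise fun i j => Disjoint (Ico (a i) (a i + r i)) (Ico (a j) (a j + r j)))
    (hΩ : Ω =ᵐ[volume] ⋃ j, Ico (a j) (a j + r j))
    {B : HilbertBasis Λ ℂ (Lp ℂ 2 (volume.restrict Ω))} {c : ℂ}
    (hB : ∀ l : Λ,
      B l = c • piecewiseLp a r Ω (fun _ => expMode l) (fun _ => continuous_expMode l))
    {u u' : Fin n → ℝ → ℂ} (hu : ∀ j x, HasDerivAt (u j) (u' j x) x)
    (huc : ∀ j, Continuous (u j)) (hu' : ∀ j, Continuous (u' j))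
    (hbd : ∀ l ∈ Λ, boundaryForm (spectrumEmbedding a r l)
      (fun j => u j (a j + r j), fun j => u j (a j)) = 0) (j : Fin n) (d : ℝ) :
    HasSum (fun l : Λ => c * ⟪B l, piecewiseLp a r Ω u huc⟫_ℂ *
        (((a j + r j - d : ℝ) : ℂ) * expMode l (a j + r j) -
          ((a j - d : ℝ) : ℂ) * expMode l (a j)))
      (((a j + r j - d : ℝ) : ℂ) * u j (a j + r j) - ((a j - d : ℝ) : ℂ) * u j (a j)) := by
  have h₁ := continuous_piSingle (j := j) (continuous_const (y := (1 : ℂ)))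
  have h₂ := continuous_piSingle (j := j) (f := fun x => ((x - d : ℝ) : ℂ)) (by fun_prop)
  rw [← inner_single_add_inner_single hr hd hΩ hu huc hu' j d h₁ h₂]
  convert! (B.hasSum_inner_mul_inner (piecewiseLp a r Ω _ h₁) (piecewiseLp a r Ω u huc)).add
    (B.hasSum_inner_mul_inner (piecewiseLp a r Ω _ h₂) (piecewiseLp a r Ω u' hu')) using 1
  -- Termwise, the coefficient of `u` factors out, leaving the same endpoint functional evaluated at
  -- `expMode l`.
  ext l
  have hgreen := inner_expMode_deriv_eq hr hd hΩ hu huc hu' (l : ℝ)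
  rw [hbd l l.2, zero_add] at hgreen
  have hl := inner_single_add_inner_single (u := fun _ => expMode l) hr hd hΩ
    (fun _ x => hasDerivAt_expMode l x) (fun _ => continuous_expMode l)
    (fun _ => (continuous_expMode l).const_mul _) j d h₁ h₂
  have hsmul : ⟪piecewiseLp a r Ω _ h₂, piecewiseLp a r Ω
      (fun _ x => 2 * (Real.pi : ℂ) * Complex.I * (l : ℂ) * expMode l x)
      (fun _ => (continuous_expMode l).const_mul _)⟫_ℂ =
      2 * (Real.pi : ℂ) * Complex.I * (l : ℂ) * ⟪piecewiseLp a r Ω _ h₂,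
        piecewiseLp a r Ω (fun _ => expMode l) (fun _ => continuous_expMode l)⟫_ℂ := by
    simp only [inner_piecewiseLp hr hd hΩ, mul_left_comm _ (2 * (Real.pi : ℂ) * Complex.I * (l : ℂ)),
      intervalIntegral.integral_const_mul, ← Finset.mul_sum]
  rw [← hl, hsmul, hB]
  simp only [inner_smul_left, inner_smul_right, hgreen]
  ring

/-- Maximality: the affine interpolant of `w` has a Fourier series whose endpoint values sum to `w`.
-/
theorem IsSpectralPair.mem_spectrumSpan (hΛ : IsSpectralPair Ω Λ) (hr : ∀ j, 0 < r j)
    (hd : Pairwise fun i j => Disjoint (Ico (a i) (a i + r i)) (Ico (a j) (a j + r j)))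
    (hΩ : Ω =ᵐ[volume] ⋃ j, Ico (a j) (a j + r j)) {w : (Fin n → ℂ) × (Fin n → ℂ)}
    (hw : ∀ l ∈ Λ, boundaryForm (spectrumEmbedding a r l) w = 0) :
    w ∈ spectrumSpan a r Λ := by
  obtain ⟨B, c, hc, hB⟩ := hΛ.exists_hilbertBasis_piecewiseLp hd hΩ
  have hr0 : ∀ j, (r j : ℂ) ≠ 0 := fun j => Complex.ofReal_ne_zero.2 (hr j).ne'
  let u' : Fin n → ℝ → ℂ := fun j _ => (w.1 j - w.2 j) / r j
  let u : Fin n → ℝ → ℂ := fun j x => w.2 j + ((x - a j : ℝ) : ℂ) * ((w.1 j - w.2 j) / r j)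
  have hu : ∀ j x, HasDerivAt (u j) (u' j x) x := fun j x => by
    have h := ((hasDerivAt_id x).sub_const (a j)).ofReal_comp
    have h2 := (h.mul_const ((w.1 j - w.2 j) / r j)).const_add (w.2 j)
    rw [Complex.ofReal_one, one_mul] at h2
    exact h2
  have huc : ∀ j, Continuous (u j) := fun j =>
    continuous_iff_continuousAt.2 fun x => (hu j x).continuousAt
  have hu' : ∀ j, Continuous (u' j) := fun j => continuous_const
  have hend : ∀ j, u j (a j + r j) = w.1 j := fun j => by
    simp only [u, add_sub_cancel_left]
    rw [mul_div_cancel₀ _ (hr0 j)]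
    ring
  have hstart : ∀ j, u j (a j) = w.2 j := fun j => by simp [u]
  have hbd : ∀ l ∈ Λ, boundaryForm (spectrumEmbedding a r l)
      (fun j => u j (a j + r j), fun j => u j (a j)) = 0 := fun l hl => by
    simpa only [hend, hstart] using hw l hl
  have hsum := IsSpectralPair.hasSum_boundary (fun j => (hr j).le) hd hΩ hB hu huc hu' hbd
  set q : Λ → ℂ := fun l => c * ⟪B l, piecewiseLp a r Ω u huc⟫_ℂ with hq
  have key : HasSum (fun l : Λ => q l • spectrumEmbedding a r l) w := by
    refine HasSum.prodMk (f := fun l : Λ => q l • (spectrumEmbedding a r l).1)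
      (g := fun l : Λ => q l • (spectrumEmbedding a r l).2) (a := w.1) (b := w.2)
      (Pi.hasSum.2 fun j => ?_) (Pi.hasSum.2 fun j => ?_)
    -- The weight `x - a j` vanishes at the left endpoint, isolating the right one.
    · have h := (hsum j (a j)).mul_left ((r j : ℂ)⁻¹)
      simp only [sub_self, add_sub_cancel_left, Complex.ofReal_zero, zero_mul, sub_zero,
        hend] at h
      rw [inv_mul_cancel_left₀ (hr0 j)] at h
      convert! h using 1
      ext l
      have := hr0 j
      simp only [Pi.smul_apply, spectrumEmbedding_eq, smul_eq_mul, hq]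
      field_simp
    -- The weight now vanishes at the right endpoint, isolating the left one.
    · have h := (hsum j (a j + r j)).mul_left ((r j : ℂ)⁻¹)
      simp only [sub_self, sub_add_cancel_left, Complex.ofReal_zero, zero_mul, zero_sub,
        Complex.ofReal_neg, neg_mul, neg_neg, hstart] at h
      rw [inv_mul_cancel_left₀ (hr0 j)] at h
      convert! h using 1
      ext l
      have := hr0 j
      simp only [Pi.smul_apply, spectrumEmbedding_eq, smul_eq_mul, hq]
      field_simp
  exact (Submodule.closed_of_finiteDimensional (spectrumSpan a r Λ)).mem_of_tendsto key
    (Filter.Eventually.of_forall fun s => Submodule.sum_mem _ fun l _ =>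
      Submodule.smul_mem _ _ (Submodule.subset_span ⟨l, l.2, rfl⟩))

/-- The embedded spectrum of a union of `n` intervals spans an `n`-dimensional space. -/
theorem IsSpectralPair.finrank_spectrumSpan (hΛ : IsSpectralPair Ω Λ) (hr : ∀ j, 0 < r j)
    (hd : Pairwise fun i j => Disjoint (Ico (a i) (a i + r i)) (Ico (a j) (a j + r j)))
    (hΩ : Ω =ᵐ[volume] ⋃ j, Ico (a j) (a j + r j)) :
    Module.finrank ℂ (spectrumSpan a r Λ) = n := by
  refine finrank_span_eq_of_boundaryForm ?_ fun w hw => hΛ.mem_spectrumSpan hr hd hΩ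
    fun l hl => hw _ ⟨l, hl, rfl⟩
  rintro _ ⟨l, hl, rfl⟩ _ ⟨m, hm, rfl⟩
  exact hΛ.boundaryForm_eq_zero (fun j => (hr j).le) hd hΩ hl hm

end SpectralPair

/-! ### The case of three intervals -/

theorem mainTheorem2 (r s a b : ℝ) (Λ : Set ℝ)
    (hr : 0 < r) (hs : 0 < s) (hrs : r + s < 1)
    (h₁₂ : Disjoint (Ico 0 r) (Ico a (a + s)))
    (h₁₃ : Disjoint (Ico 0 r) (Ico b (b + (1 - r - s))))
    (h₂₃ : Disjoint (Ico a (a + s)) (Ico b (b + (1 - r - s))))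
    (hΛ : IsSpectralPair (Icc 0 r ∪ Icc a (a + s) ∪ Icc b (b + (1 - r - s))) Λ) :
    Module.finrank ℂ (spectrumSpan ![0, a, b] ![r, s, 1 - r - s] Λ) = 3 := by
  refine hΛ.finrank_spectrumSpan ?_ ?_ ?_
  · intro j
    fin_cases j
    · exact hr
    · exact hs
    · change 0 < 1 - r - s
      linarith
  · intro i j hij
    fin_cases i <;> fin_cases j <;>
      simp_all [Disjoint.symm]
  · have hU : (⋃ j : Fin 3, Ico ((![0, a, b] : Fin 3 → ℝ) j)
        ((![0, a, b] : Fin 3 → ℝ) j + (![r, s, 1 - r - s] : Fin 3 → ℝ) j)) =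
        Ico 0 r ∪ Ico a (a + s) ∪ Ico b (b + (1 - r - s)) := by
      ext x
      simp [Fin.exists_fin_succ, or_assoc]
    rw [hU]
    -- Closed and half-open intervals differ by null sets, so touching intervals are allowed.
    exact ((Ico_ae_eq_Icc.union Ico_ae_eq_Icc).union Ico_ae_eq_Icc).symm
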